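/- **Theorem.** Let $\mathrm{Aut}(\mathbb{C}^2)$ be the group, under composition, of polynomial maps $F:\mathbb{C}^2\to\mathbb{C}^2$ that have a polynomial inverse. For $F=(F_1,F_2)\in\mathrm{Aut}(\mathbb{C}^2)$ put $\mathrm{mdeg}\,F=(\deg F_1,\deg F_2)$, where $\deg$ is the total degree; $F$ is called affine if $\mathrm{mdeg}\,F=(1,1)$. Every $F\in\mathrm{Aut}(\mathbb{C}^2)$ can be written as $$F=L_2\circ T_l\circ\cdots\circ T_1\circ L_1$$ with $l\ge 0$, with $L_1,L_2$ affine automorphisms, and with $T_i(x,y)=(x,\,y+f_i(x))$ for odd $i$ and $T_i(x,y)=(x+f_i(y),\,y)$ for even $i$, where $f_1,\dots,f_l\in\mathbb{C}[T]$ are one-variable polynomials of degree greater than $1$. The number $l$ is uniquely determined by $F$ and is called the length of $F$. Let $d_1,d_2$ be integers with $1<d_1<d_2$ and $d_1\mid d_2$. 1. If $F\in\mathrm{Aut}(\mathbb{C}^2)$ has length $2$ and $\mathrm{mdeg}\,F=(d_1,d_2)$, then $$\mathrm{mdeg}\,F^{-1}\in\left\{\left(d_2,\tfrac{d_2}{d_1}\right),\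 \left(\tfrac{d_2}{d_1},d_2\right),\ (d_2,d_2)\right\}.$$ 2. Each of the three values occurs: for each of the three pairs $m$ in this set there is an $F\in\mathrm{Aut}(\mathbb{C}^2)$ of length $2$ with $\mathrm{mdeg}\,F=(d_1,d_2)$ and $\mathrm{mdeg}\,F^{-1}=m$. -/

import Mathlib

namespace PolyAut

/-- A polynomial mapping `ℂⁿ → ℂⁿ`, given by its coordinate polynomials `(F₁, …, Fₙ)`. -/
@[ext]
structure PolyMap (n : ℕ) where
  coord : Fin n → MvPolynomial (Fin n) ℂ

namespace PolyMap

/-- The point of `ℂⁿ` to which a polynomial mapping sends `x`. -/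
noncomputable def eval {n : ℕ} (F : PolyMap n) (x : Fin n → ℂ) : Fin n → ℂ :=
  fun i => MvPolynomial.eval x (F.coord i)

/-- The identity mapping `(X₁, …, Xₙ)`. -/
noncomputable def id (n : ℕ) : PolyMap n := ⟨fun i => MvPolynomial.X i⟩

/-- The composition `F ∘ G`: the coordinates of `G` are substituted into those of `F`. -/
noncomputable def comp {n : ℕ} (F G : PolyMap n) : PolyMap n :=
  ⟨fun i => MvPolynomial.bind₁ G.coord (F.coord i)⟩

theorem eval_comp {n : ℕ} (F G : PolyMap n) (x : Fin n → ℂ) :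
    (F.comp G).eval x = F.eval (G.eval x) := by
  funext i
  simp only [eval, comp, MvPolynomial.eval, MvPolynomial.eval₂Hom_bind₁]
  rfl

/-- Polynomial mappings `ℂⁿ → ℂⁿ` form a monoid under composition, `F * G = F ∘ G`. -/
noncomputable instance (n : ℕ) : Monoid (PolyMap n) where
  mul := comp
  one := id n
  mul_assoc F G H := by
    apply PolyMap.ext
    funext i
    exact MvPolynomial.bind₁_bind₁ G.coord H.coord (F.coord i)
  one_mul F := by
    apply PolyMap.ext
    funext i
    exact MvPolynomial.bind₁_X_right F.coord i
  mul_one F := by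
    apply PolyMap.ext
    funext i
    exact MvPolynomial.aeval_X_left_apply (F.coord i)

theorem mul_def {n : ℕ} (F G : PolyMap n) : F * G = F.comp G := rfl

theorem one_def {n : ℕ} : (1 : PolyMap n) = id n := rfl

end PolyMap

/-- `Aut(ℂⁿ)`: the polynomial mappings with a polynomial inverse, as a group under composition. -/
abbrev Aut (n : ℕ) : Type := (PolyMap n)ˣ

/-- The multidegree `(deg F₁, …, deg Fₙ)`. -/
noncomputable def mdeg {n : ℕ} (F : PolyMap n) : Fin n → ℕ :=
  fun i => (F.coord i).totalDegree

/-- Affine automorphisms: all coordinates have degree one. -/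
def IsAffine {n : ℕ} (F : Aut n) : Prop := ∀ i, mdeg F.val i = 1

/-- The polynomial mapping `(x, y) ↦ (x, y + f(x))`. -/
noncomputable def lowerMap (f : Polynomial ℂ) : PolyMap 2 :=
  ⟨![MvPolynomial.X 0, MvPolynomial.X 1 + Polynomial.aeval (MvPolynomial.X 0) f]⟩

/-- The polynomial mapping `(x, y) ↦ (x + f(y), y)`. -/
noncomputable def upperMap (f : Polynomial ℂ) : PolyMap 2 :=
  ⟨![MvPolynomial.X 0 + Polynomial.aeval (MvPolynomial.X 1) f, MvPolynomial.X 1]⟩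

theorem lowerMap_mul (f g : Polynomial ℂ) : lowerMap f * lowerMap g = lowerMap (g + f) := by
  apply PolyMap.ext
  funext i
  fin_cases i
  · simp [PolyMap.mul_def, PolyMap.comp, lowerMap]
  · simp [PolyMap.mul_def, PolyMap.comp, lowerMap, ← Polynomial.aeval_algHom_apply, add_assoc]

theorem upperMap_mul (f g : Polynomial ℂ) : upperMap f * upperMap g = upperMap (g + f) := by
  apply PolyMap.ext
  funext i
  fin_cases i
  · simp [PolyMap.mul_def, PolyMap.comp, upperMap, ← Polynomial.aeval_algHom_apply, add_assoc]
  · simp [PolyMap.mul_def, PolyMap.comp, upperMap]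

theorem lowerMap_zero : lowerMap 0 = 1 := by
  apply PolyMap.ext
  funext i
  fin_cases i <;> simp [PolyMap.one_def, PolyMap.id, lowerMap]

theorem upperMap_zero : upperMap 0 = 1 := by
  apply PolyMap.ext
  funext i
  fin_cases i <;> simp [PolyMap.one_def, PolyMap.id, upperMap]

/-- The triangular automorphism `(x, y) ↦ (x, y + f(x))`. -/
noncomputable def lower (f : Polynomial ℂ) : Aut 2 where
  val := lowerMap f
  inv := lowerMap (-f)
  val_inv := by rw [lowerMap_mul, neg_add_cancel, lowerMap_zero]
  inv_val := by rw [lowerMap_mul, add_neg_cancel, lowerMap_zero]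

/-- The triangular automorphism `(x, y) ↦ (x + f(y), y)`. -/
noncomputable def upper (f : Polynomial ℂ) : Aut 2 where
  val := upperMap f
  inv := upperMap (-f)
  val_inv := by rw [upperMap_mul, neg_add_cancel, upperMap_zero]
  inv_val := by rw [upperMap_mul, add_neg_cancel, upperMap_zero]

/-- The `i`-th triangular factor `Tᵢ`: `(x, y + fᵢ(x))` for odd `i`, `(x + fᵢ(y), y)` for even
`i`. -/
noncomputable def factor (f : ℕ → Polynomial ℂ) (i : ℕ) : Aut 2 :=
  if Odd i then lower (f i) else upper (f i)

/-- The composition `T_l ∘ ⋯ ∘ T₁`. -/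
noncomputable def chain (f : ℕ → Polynomial ℂ) : ℕ → Aut 2
  | 0 => 1
  | l + 1 => factor f (l + 1) * chain f l

/-- `F = L₂ ∘ T_l ∘ ⋯ ∘ T₁ ∘ L₁` with `L₁, L₂` affine and `T₁, …, T_l` alternating triangular
automorphisms given by one-variable polynomials `f₁, …, f_l` of degree greater than one. -/
def HasDecomposition (F : Aut 2) (l : ℕ) : Prop :=
  ∃ (L₁ L₂ : Aut 2) (f : ℕ → Polynomial ℂ),
    IsAffine L₁ ∧ IsAffine L₂ ∧ (∀ i ∈ Finset.Icc 1 l, 1 < (f i).natDegree) ∧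
      F = L₂ * chain f l * L₁

/-- The length of an automorphism of `ℂ²`: the number `l` of triangular factors in a decomposition
as in `HasDecomposition`. Such a decomposition always exists and its `l` is unique, so that the
infimum is over a one-element set. -/
noncomputable def length (F : Aut 2) : ℕ := sInf {l : ℕ | HasDecomposition F l}

end PolyAut

open MvPolynomial

/-! Write F = L₂ ∘ T₂ ∘ T₁ ∘ L₁ with T₁, T₂ given by f, g. The degrees of the coordinates grow from
(1, 1) to (1, deg f) to (deg g · deg f, deg f), since each substitution dominates the term it is
added to. A row of L₂ keeps the larger degree unless its coefficient there is 0, so d₁ < d₂ forces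
d₁ = deg f and d₂ = deg g · deg f.

The inverse has the same shape with the triangular factors in reverse order, so the smaller degree
is now deg g = d₂ / d₁. A coordinate takes this value exactly when the y-coefficient in that row of
L₁⁻¹ is 0. Invertibility prevents both from vanishing, which leaves three patterns, and a choice of
L₁ realises each of them.

Neither existence nor uniqueness of decompositions in general is needed. -/

theorem MvPolynomial.totalDegree_polynomial_aeval_le {σ : Type*} (P : MvPolynomial σ ℂ)
    (f : Polynomial ℂ) :
    (Polynomial.aeval P f).totalDegree ≤ f.natDegree * P.totalDegree := by
  rw [Polynomial.aeval_eq_sum_range]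
  refine totalDegree_finsetSum_le fun i hi => (totalDegree_smul_le _ _).trans ?_
  refine (totalDegree_pow _ _).trans (Nat.mul_le_mul_right _ ?_)
  exact Nat.lt_succ_iff.mp (Finset.mem_range.mp hi)

theorem MvPolynomial.totalDegree_C_mul_of_ne_zero {σ : Type*} {a : ℂ} (ha : a ≠ 0)
    (P : MvPolynomial σ ℂ) : (C a * P).totalDegree = P.totalDegree := by
  by_cases hP : P = 0
  · simp [hP]
  · rw [totalDegree_mul_of_isDomain (by simpa using ha) hP, totalDegree_C, zero_add]

theorem MvPolynomial.totalDegree_pow_of_isDomain {σ : Type*} {P : MvPolynomial σ ℂ} (hP : P ≠ 0)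
    (n : ℕ) : (P ^ n).totalDegree = n * P.totalDegree := by
  induction n with
  | zero => simp
  | succ n ih => rw [pow_succ, totalDegree_mul_of_isDomain (pow_ne_zero _ hP) hP, ih]; ring

/-- In a domain the powers of a nonconstant P have strictly increasing degrees, so the leading term
of f cannot be cancelled. -/
theorem MvPolynomial.totalDegree_polynomial_aeval {σ : Type*} {P : MvPolynomial σ ℂ}
    (hP : 0 < P.totalDegree) (f : Polynomial ℂ) :
    (Polynomial.aeval P f).totalDegree = f.natDegree * P.totalDegree := by
  rcases Nat.eq_zero_or_pos f.natDegree with h0 | hpos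
  · exact le_antisymm (totalDegree_polynomial_aeval_le P f) (by simp [h0])
  have hP0 : P ≠ 0 := by rintro rfl; simp at hP
  have hf : f.leadingCoeff ≠ 0 := by
    rw [Polynomial.leadingCoeff_ne_zero]; rintro rfl; simp at hpos
  have hlead : (C f.leadingCoeff * P ^ f.natDegree).totalDegree = f.natDegree * P.totalDegree := by
    rw [totalDegree_C_mul_of_ne_zero hf, totalDegree_pow_of_isDomain hP0]
  conv_lhs => rw [← f.eraseLead_add_C_mul_X_pow]
  rw [map_add, map_mul, map_pow, Polynomial.aeval_X, Polynomial.aeval_C, algebraMap_eq,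
    totalDegree_add_eq_right_of_totalDegree_lt, hlead]
  rw [hlead]
  refine (totalDegree_polynomial_aeval_le P _).trans_lt (Nat.mul_lt_mul_of_pos_right ?_ hP)
  have := f.eraseLead_natDegree_le
  omega

theorem MvPolynomial.totalDegree_add_C {σ : Type*} (P : MvPolynomial σ ℂ) (c : ℂ) :
    (P + C c).totalDegree = P.totalDegree := by
  have key : ∀ (Q : MvPolynomial σ ℂ) (b : ℂ), (Q + C b).totalDegree ≤ Q.totalDegree := fun Q b =>
    (totalDegree_add _ _).trans (by simp)
  refine le_antisymm (key P c) ?_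
  have h := key (P + C c) (-c)
  rwa [C_neg, add_neg_cancel_right] at h

theorem MvPolynomial.totalDegree_combination_of_lt {σ : Type*} {P Q : MvPolynomial σ ℂ}
    (h : Q.totalDegree < P.totalDegree) {a b : ℂ} (c : ℂ) (hab : a ≠ 0 ∨ b ≠ 0) :
    (C a * P + C b * Q + C c).totalDegree =
      if a = 0 then Q.totalDegree else P.totalDegree := by
  rw [totalDegree_add_C]
  split_ifs with ha
  · have hb : b ≠ 0 := hab.resolve_left (not_not_intro ha)
    rw [ha, C_0, zero_mul, zero_add, totalDegree_C_mul_of_ne_zero hb]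
  · have hb : (C b * Q).totalDegree ≤ Q.totalDegree := (totalDegree_mul _ _).trans (by simp)
    rw [totalDegree_add_eq_left_of_totalDegree_lt] <;> rw [totalDegree_C_mul_of_ne_zero ha]
    omega

theorem MvPolynomial.eq_affine_of_totalDegree_le_one {p : MvPolynomial (Fin 2) ℂ}
    (hp : p.totalDegree ≤ 1) :
    ∃ a b c : ℂ, p = C a * X 0 + C b * X 1 + C c := by
  refine ⟨coeff (Finsupp.single 0 1) p, coeff (Finsupp.single 1 1) p, coeff 0 p, ?_⟩
  ext m
  by_cases hm : 2 ≤ m 0 + m 1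
  · have h0 : m ≠ 0 := by rintro rfl; simp at hm
    have h1 : ∀ i : Fin 2, Finsupp.single i 1 ≠ m := by
      rintro i rfl
      fin_cases i <;> simp at hm
    rw [coeff_eq_zero_of_totalDegree_lt]
    · simp [coeff_C_mul, coeff_X, coeff_C, h1, h0.symm]
    · rw [← Finsupp.degree_apply, Finsupp.degree_eq_sum, Fin.sum_univ_two]
      omega
  · have key : m = 0 ∨ m = Finsupp.single 0 1 ∨ m = Finsupp.single 1 1 := by
      have : (m 0 = 0 ∧ m 1 = 0) ∨ (m 0 = 1 ∧ m 1 = 0) ∨ (m 0 = 0 ∧ m 1 = 1) := by omega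
      rcases this with h | h | h
      · left; ext i; fin_cases i <;> simp [h]
      · right; left; ext i; fin_cases i <;> simp [h]
      · right; right; ext i; fin_cases i <;> simp [h]
    have e1 : (Finsupp.single (0 : Fin 2) 1 : Fin 2 →₀ ℕ) ≠ Finsupp.single 1 1 := fun h => by
      simpa using DFunLike.congr_fun h 0
    rcases key with rfl | rfl | rfl <;>
      simp [coeff_C_mul, coeff_X, coeff_C, e1, e1.symm, eq_comm]

/-! ### Affine automorphisms -/

namespace PolyAut

/-- The coordinates of `L` are `aᵢ x + bᵢ y + cᵢ`. -/
def HasAffineForm (L : PolyMap 2) (a b c : Fin 2 → ℂ) : Prop :=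
  ∀ i, L.coord i = C (a i) * X 0 + C (b i) * X 1 + C (c i)

theorem IsAffine.exists_form {L : Aut 2} (hL : IsAffine L) :
    ∃ a b c, HasAffineForm L.val a b c := by
  choose a b c h using fun i => eq_affine_of_totalDegree_le_one (hL i).le
  exact ⟨a, b, c, h⟩

theorem HasAffineForm.comp_coord {L : PolyMap 2} {a b c : Fin 2 → ℂ} (h : HasAffineForm L a b c)
    (G : PolyMap 2) (i : Fin 2) :
    (L * G).coord i = C (a i) * G.coord 0 + C (b i) * G.coord 1 + C (c i) := by
  change bind₁ G.coord (L.coord i) = _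
  rw [h i]
  simp

theorem HasAffineForm.det_ne_zero {L : Aut 2} {a b c : Fin 2 → ℂ}
    (h : HasAffineForm L.val a b c) : a 0 * b 1 - a 1 * b 0 ≠ 0 := by
  have key : ∀ (x : Fin 2 → ℂ) (i : Fin 2),
      a i * (L⁻¹).val.eval x 0 + b i * (L⁻¹).val.eval x 1 + c i = x i := by
    intro x i
    have h1 : (L.val * (L⁻¹).val).coord i = X i := by rw [Units.mul_inv]; rfl
    rw [h.comp_coord] at h1
    simpa [PolyMap.eval] using congrArg (MvPolynomial.eval x) h1
  intro hdet
  have p0 := key ![0, 0] 0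
  have p1 := key ![0, 0] 1
  have q0 := key ![1, 0] 0
  have q1 := key ![1, 0] 1
  have r0 := key ![0, 1] 0
  have r1 := key ![0, 1] 1
  generalize (L⁻¹).val.eval ![0, 0] 0 = s at *
  generalize (L⁻¹).val.eval ![0, 0] 1 = t at *
  generalize (L⁻¹).val.eval ![1, 0] 0 = s' at *
  generalize (L⁻¹).val.eval ![1, 0] 1 = t' at *
  generalize (L⁻¹).val.eval ![0, 1] 0 = s'' at *
  generalize (L⁻¹).val.eval ![0, 1] 1 = t'' at *
  simp at p0 p1 q0 q1 r0 r1
  -- Differences of preimages remove the translation and give columns of an inverse of the linear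
  -- part.
  have u0 : a 0 * (s' - s) + b 0 * (t' - t) = 1 := by linear_combination q0 - p0
  have u1 : a 1 * (s' - s) + b 1 * (t' - t) = 0 := by linear_combination q1 - p1
  have v0 : a 0 * (s'' - s) + b 0 * (t'' - t) = 0 := by linear_combination r0 - p0
  have v1 : a 1 * (s'' - s) + b 1 * (t'' - t) = 1 := by linear_combination r1 - p1
  -- Multiplicativity of the determinant, written out for 2 × 2 matrices.
  have : (1 : ℂ) = 0 := by
    linear_combination ((s' - s) * (t'' - t) - (s'' - s) * (t' - t)) * hdet
      - (a 1 * (s'' - s) + b 1 * (t'' - t)) * u0 - v1 + (a 0 * (s'' - s) + b 0 * (t'' - t)) * u1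
  exact one_ne_zero this

theorem HasAffineForm.row_ne_zero {L : Aut 2} {a b c : Fin 2 → ℂ}
    (h : HasAffineForm L.val a b c) (i : Fin 2) : a i ≠ 0 ∨ b i ≠ 0 := by
  by_contra! hi
  refine h.det_ne_zero ?_
  fin_cases i <;> simp at hi <;> simp [hi]

theorem HasAffineForm.isAffine {L : Aut 2} {a b c : Fin 2 → ℂ}
    (h : HasAffineForm L.val a b c) : IsAffine L := by
  intro i
  change (L.val.coord i).totalDegree = 1
  rw [h i, totalDegree_add_C]
  refine le_antisymm ((totalDegree_add _ _).trans (max_le ?_ ?_)) ?_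
  · exact (totalDegree_mul _ _).trans (by simp)
  · exact (totalDegree_mul _ _).trans (by simp)
  · have e1 : (Finsupp.single (0 : Fin 2) 1 : Fin 2 →₀ ℕ) ≠ Finsupp.single 1 1 := fun h => by
      simpa using DFunLike.congr_fun h 0
    rcases h.row_ne_zero i with hi | hi
    · have := le_totalDegree (σ := Fin 2) (p := C (a i) * X 0 + C (b i) * X 1) (s := Finsupp.single 0 1)
        (by simp [mem_support_iff, coeff_C_mul, coeff_X, e1.symm, hi])
      simpa using this
    · have := le_totalDegree (σ := Fin 2) (p := C (a i) * X 0 + C (b i) * X 1) (s := Finsupp.single 1 1)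
        (by simp [mem_support_iff, coeff_C_mul, coeff_X, e1, hi])
      simpa using this

theorem HasAffineForm.inv {L : Aut 2} {a b c : Fin 2 → ℂ} (h : HasAffineForm L.val a b c) :
    ∃ a' b' c', HasAffineForm (L⁻¹).val a' b' c' := by
  have h1 : ∀ i, (L.val * (L⁻¹).val).coord i = X i := fun i => by rw [Units.mul_inv]; rfl
  simp only [h.comp_coord] at h1
  have hdet := h.det_ne_zero
  set d := a 0 * b 1 - a 1 * b 0 with hd
  have hC : (C d⁻¹ * C d : MvPolynomial (Fin 2) ℂ) = 1 := by
    rw [← C_mul, inv_mul_cancel₀ hdet, C_1]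
  have hdC : (C d : MvPolynomial (Fin 2) ℂ) = C (a 0) * C (b 1) - C (a 1) * C (b 0) := by
    rw [hd]; simp
  have e0 := h1 0
  have e1 := h1 1
  -- Cramer's rule.
  refine ⟨![d⁻¹ * b 1, -(d⁻¹ * a 1)], ![-(d⁻¹ * b 0), d⁻¹ * a 0],
    ![d⁻¹ * (b 0 * c 1 - b 1 * c 0), d⁻¹ * (a 1 * c 0 - a 0 * c 1)], fun i => ?_⟩
  fin_cases i
  · simp
    linear_combination (C d⁻¹ * C (b 1)) * e0 - (C d⁻¹ * C (b 0)) * e1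
      - (L⁻¹).val.coord 0 * hC + C d⁻¹ * (L⁻¹).val.coord 0 * hdC
  · simp
    linear_combination (C d⁻¹ * C (a 0)) * e1 - (C d⁻¹ * C (a 1)) * e0
      - (L⁻¹).val.coord 1 * hC + C d⁻¹ * (L⁻¹).val.coord 1 * hdC

theorem IsAffine.inv {L : Aut 2} (hL : IsAffine L) : IsAffine L⁻¹ := by
  obtain ⟨a, b, c, h⟩ := hL.exists_form
  obtain ⟨a', b', c', h'⟩ := h.inv
  exact h'.isAffine

/-! ### Degrees of compositions -/

theorem lowerMap_mul_coord_zero (f : Polynomial ℂ) (G : PolyMap 2) :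
    (lowerMap f * G).coord 0 = G.coord 0 := by
  simp [PolyMap.mul_def, PolyMap.comp, lowerMap]

theorem lowerMap_mul_coord_one (f : Polynomial ℂ) (G : PolyMap 2) :
    (lowerMap f * G).coord 1 = G.coord 1 + Polynomial.aeval (G.coord 0) f := by
  simp [PolyMap.mul_def, PolyMap.comp, lowerMap, ← Polynomial.aeval_algHom_apply]

theorem upperMap_mul_coord_zero (f : Polynomial ℂ) (G : PolyMap 2) :
    (upperMap f * G).coord 0 = G.coord 0 + Polynomial.aeval (G.coord 1) f := by
  simp [PolyMap.mul_def, PolyMap.comp, upperMap, ← Polynomial.aeval_algHom_apply]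

theorem upperMap_mul_coord_one (f : Polynomial ℂ) (G : PolyMap 2) :
    (upperMap f * G).coord 1 = G.coord 1 := by
  simp [PolyMap.mul_def, PolyMap.comp, upperMap]

theorem totalDegree_add_polynomial_aeval {P Q : MvPolynomial (Fin 2) ℂ} {f : Polynomial ℂ}
    (hP : 0 < P.totalDegree) (hf : 1 < f.natDegree) (hQ : Q.totalDegree ≤ P.totalDegree) :
    (Q + Polynomial.aeval P f).totalDegree = f.natDegree * P.totalDegree := by
  rw [totalDegree_add_eq_right_of_totalDegree_lt, totalDegree_polynomial_aeval hP]
  rw [totalDegree_polynomial_aeval hP]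
  nlinarith

theorem mdeg_affine_mul_upper_mul_lower {L₁ L₂ : Aut 2} {a b c : Fin 2 → ℂ} {f g : Polynomial ℂ}
    (h₁ : IsAffine L₁) (h₂ : HasAffineForm L₂.val a b c) (hf : 1 < f.natDegree)
    (hg : 1 < g.natDegree) (i : Fin 2) :
    mdeg (L₂ * (upper g * lower f) * L₁).val i =
      if a i = 0 then f.natDegree else g.natDegree * f.natDegree := by
  have e : (L₂ * (upper g * lower f) * L₁).val =
    L₂.val * (upperMap g * (lowerMap f * L₁.val)) := by simp [mul_assoc, upper, lower]
  have u0 : (L₁.val.coord 0).totalDegree = 1 := h₁ 0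
  have u1 : (L₁.val.coord 1).totalDegree = 1 := h₁ 1
  have hQ : ((lowerMap f * L₁.val).coord 1).totalDegree = f.natDegree := by
    rw [lowerMap_mul_coord_one, totalDegree_add_polynomial_aeval (by omega) hf (by omega), u0,
      mul_one]
  have hP : ((upperMap g * (lowerMap f * L₁.val)).coord 0).totalDegree =
      g.natDegree * f.natDegree := by
    rw [upperMap_mul_coord_zero, lowerMap_mul_coord_zero,
      totalDegree_add_polynomial_aeval (by omega) hg (by omega), hQ]
  rw [e, mdeg, h₂.comp_coord, totalDegree_combination_of_lt _ _ (h₂.row_ne_zero i), hP,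
    upperMap_mul_coord_one, hQ]
  rw [hP, upperMap_mul_coord_one, hQ]
  nlinarith

theorem mdeg_affine_mul_lower_mul_upper {L₁ L₂ : Aut 2} {a b c : Fin 2 → ℂ} {f g : Polynomial ℂ}
    (h₁ : IsAffine L₁) (h₂ : HasAffineForm L₂.val a b c) (hf : 1 < f.natDegree)
    (hg : 1 < g.natDegree) (i : Fin 2) :
    mdeg (L₂ * (lower f * upper g) * L₁).val i =
      if b i = 0 then g.natDegree else f.natDegree * g.natDegree := by
  have e : (L₂ * (lower f * upper g) * L₁).val =
    L₂.val * (lowerMap f * (upperMap g * L₁.val)) := by simp [mul_assoc, upper, lower]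
  have u0 : (L₁.val.coord 0).totalDegree = 1 := h₁ 0
  have u1 : (L₁.val.coord 1).totalDegree = 1 := h₁ 1
  have hQ : ((upperMap g * L₁.val).coord 0).totalDegree = g.natDegree := by
    rw [upperMap_mul_coord_zero, totalDegree_add_polynomial_aeval (by omega) hg (by omega), u1,
      mul_one]
  have hP : ((lowerMap f * (upperMap g * L₁.val)).coord 1).totalDegree =
      f.natDegree * g.natDegree := by
    rw [lowerMap_mul_coord_one, upperMap_mul_coord_one,
      totalDegree_add_polynomial_aeval (by omega) hf (by omega), hQ]
  rw [e, mdeg, h₂.comp_coord, add_comm (C (a i) * _),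
    totalDegree_combination_of_lt _ _ (h₂.row_ne_zero i).symm, hP, lowerMap_mul_coord_zero, hQ]
  rw [hP, lowerMap_mul_coord_zero, hQ]
  nlinarith

theorem mdeg_affine_mul_lower {L₁ L₂ : Aut 2} {f : Polynomial ℂ} (h₁ : IsAffine L₁)
    (h₂ : IsAffine L₂) (hf : 1 < f.natDegree) (i : Fin 2) :
    mdeg (L₂ * lower f * L₁).val i = 1 ∨ mdeg (L₂ * lower f * L₁).val i = f.natDegree := by
  obtain ⟨a, b, c, h⟩ := h₂.exists_form
  have e : (L₂ * lower f * L₁).val = L₂.val * (lowerMap f * L₁.val) := by simp [mul_assoc, lower]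
  have u0 : (L₁.val.coord 0).totalDegree = 1 := h₁ 0
  have u1 : (L₁.val.coord 1).totalDegree = 1 := h₁ 1
  have hQ : ((lowerMap f * L₁.val).coord 1).totalDegree = f.natDegree := by
    rw [lowerMap_mul_coord_one, totalDegree_add_polynomial_aeval (by omega) hf (by omega), u0,
      mul_one]
  rw [e, mdeg, h.comp_coord, add_comm (C (a i) * _),
    totalDegree_combination_of_lt _ _ (h.row_ne_zero i).symm, hQ, lowerMap_mul_coord_zero, u0]
  · split_ifs <;> simp
  · rw [hQ, lowerMap_mul_coord_zero, u0]; exact hf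

theorem mdeg_affine_mul_affine_le {L₁ L₂ : Aut 2} (h₁ : IsAffine L₁) (h₂ : IsAffine L₂)
    (i : Fin 2) : mdeg (L₂ * L₁).val i ≤ 1 := by
  obtain ⟨a, b, c, h⟩ := h₂.exists_form
  have u0 : (L₁.val.coord 0).totalDegree = 1 := h₁ 0
  have u1 : (L₁.val.coord 1).totalDegree = 1 := h₁ 1
  rw [Units.val_mul, mdeg, h.comp_coord, totalDegree_add_C]
  refine (totalDegree_add _ _).trans (max_le ?_ ?_)
  · exact (totalDegree_mul _ _).trans (by simp [u0])
  · exact (totalDegree_mul _ _).trans (by simp [u1])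

/-! ### Decompositions and length -/

theorem chain_one (f : ℕ → Polynomial ℂ) : chain f 1 = lower (f 1) := by
  simp [chain, factor]

theorem chain_two (f : ℕ → Polynomial ℂ) : chain f 2 = upper (f 2) * lower (f 1) := by
  have h : ¬ Odd 2 := by decide
  simp [chain, factor, h]

theorem lower_inv (f : Polynomial ℂ) : (lower f)⁻¹ = lower (-f) := Units.ext rfl

theorem upper_inv (f : Polynomial ℂ) : (upper f)⁻¹ = upper (-f) := Units.ext rfl

theorem hasDecomposition_two_iff {F : Aut 2} :
    HasDecomposition F 2 ↔ ∃ (L₁ L₂ : Aut 2) (f g : Polynomial ℂ), IsAffine L₁ ∧ IsAffine L₂ ∧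
      1 < f.natDegree ∧ 1 < g.natDegree ∧ F = L₂ * (upper g * lower f) * L₁ := by
  constructor
  · rintro ⟨L₁, L₂, f, h₁, h₂, hf, hF⟩
    exact ⟨L₁, L₂, f 1, f 2, h₁, h₂, hf 1 (by simp), hf 2 (by simp), chain_two f ▸ hF⟩
  · rintro ⟨L₁, L₂, f, g, h₁, h₂, hf, hg, hF⟩
    refine ⟨L₁, L₂, fun i => if i = 1 then f else g, h₁, h₂, fun i _ => ?_, ?_⟩
    · dsimp only
      split_ifs <;> assumption
    · rw [chain_two, hF]; rfl

/-- With at most one triangular factor, the coordinate degrees cannot be two distinct numbers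
greater than 1. -/
theorem length_eq_two {F : Aut 2} (hF : HasDecomposition F 2) (h0 : 1 < mdeg F.val 0)
    (h01 : mdeg F.val 0 < mdeg F.val 1) : length F = 2 := by
  have hmem : HasDecomposition F (length F) := Nat.sInf_mem (s := {l | HasDecomposition F l}) ⟨2, hF⟩
  have hle : length F ≤ 2 := Nat.sInf_le hF
  obtain ⟨L₁, L₂, f, h₁, h₂, hf, hFe⟩ := hmem
  interval_cases hl : length F
  · have h := mdeg_affine_mul_affine_le h₁ h₂ 0
    rw [hFe] at h0
    simp only [chain, mul_one] at h0
    omega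
  · rw [chain_one] at hFe
    have hf1 := hf 1 (by simp)
    have k0 := mdeg_affine_mul_lower h₁ h₂ hf1 0
    have k1 := mdeg_affine_mul_lower h₁ h₂ hf1 1
    rw [← hFe] at k0 k1
    omega
  · rfl

/-- The automorphism `(x, y) ↦ (y, x)`. -/
noncomputable def swap : Aut 2 where
  val := ⟨![X 1, X 0]⟩
  inv := ⟨![X 1, X 0]⟩
  val_inv := by
    apply PolyMap.ext
    funext i
    fin_cases i <;> simp [PolyMap.mul_def, PolyMap.comp, PolyMap.one_def, PolyMap.id]
  inv_val := by
    apply PolyMap.ext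
    funext i
    fin_cases i <;> simp [PolyMap.mul_def, PolyMap.comp, PolyMap.one_def, PolyMap.id]

theorem swap_form : HasAffineForm swap.val ![0, 1] ![1, 0] ![0, 0] := by
  intro i
  fin_cases i <;> simp [swap]

theorem swap_inv : swap⁻¹ = swap := Units.ext rfl

theorem one_form : HasAffineForm (1 : Aut 2).val ![1, 0] ![0, 1] ![0, 0] := by
  intro i
  fin_cases i <;> simp [PolyMap.one_def, PolyMap.id]

theorem upper_X_form : HasAffineForm (upper Polynomial.X).val ![1, 0] ![1, 1] ![0, 0] := by
  intro i
  fin_cases i <;> simp [upper, upperMap]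

/-! ### Multidegree of the inverse -/

theorem mdeg_inv_mem {F : Aut 2} {d₁ d₂ : ℕ} (h : d₁ < d₂)
    (hF : HasDecomposition F 2) (hd : mdeg F.val = ![d₁, d₂]) :
    mdeg (F⁻¹).val ∈ ({![d₂, d₂ / d₁], ![d₂ / d₁, d₂], ![d₂, d₂]} : Set (Fin 2 → ℕ)) := by
  obtain ⟨L₁, L₂, f, g, h₁, h₂, hf, hg, rfl⟩ := hasDecomposition_two_iff.mp hF
  obtain ⟨a, b, c, hL⟩ := h₂.exists_form
  obtain ⟨a', b', c', hL'⟩ := h₁.inv.exists_form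
  have e0 := mdeg_affine_mul_upper_mul_lower h₁ hL hf hg 0
  have e1 := mdeg_affine_mul_upper_mul_lower h₁ hL hf hg 1
  rw [hd] at e0 e1
  simp only [Matrix.cons_val_zero, Matrix.cons_val_one] at e0 e1
  have hlt : f.natDegree < g.natDegree * f.natDegree := by nlinarith
  -- Only the case `a 0 = 0`, `a 1 ≠ 0` is compatible with d₁ < d₂.
  have hd₁ : d₁ = f.natDegree := by split_ifs at e0 e1 <;> omega
  have hd₂ : d₂ = g.natDegree * f.natDegree := by split_ifs at e0 e1 <;> omega
  have hdiv : d₂ / d₁ = g.natDegree := by rw [hd₁, hd₂, Nat.mul_div_cancel _ (by omega)]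
  have einv : (L₂ * (upper g * lower f) * L₁)⁻¹ =
      L₁⁻¹ * (lower (-f) * upper (-g)) * L₂⁻¹ := by
    rw [← lower_inv, ← upper_inv]; group
  have k := mdeg_affine_mul_lower_mul_upper (f := -f) (g := -g) h₂.inv hL' (by simpa) (by simpa)
  rw [← einv, Polynomial.natDegree_neg, Polynomial.natDegree_neg, mul_comm, ← hd₂, ← hdiv] at k
  have hdet := hL'.det_ne_zero
  have hm : mdeg (L₂ * (upper g * lower f) * L₁)⁻¹.val =
      ![if b' 0 = 0 then d₂ / d₁ else d₂, if b' 1 = 0 then d₂ / d₁ else d₂] := by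
    funext i
    fin_cases i
    · exact k 0
    · exact k 1
  rw [hm]
  by_cases hb0 : b' 0 = 0
  · have hb1 : b' 1 ≠ 0 := by rintro hb1; simp [hb0, hb1] at hdet
    simp [hb0, hb1]
  · by_cases hb1 : b' 1 = 0 <;> simp [hb0, hb1]

/-- With `L⁻¹` as innermost factor of F, `L` is the outermost factor of F⁻¹, so its y-coefficients
prescribe the degrees; an outer `swap` puts the smaller degree of F first. -/
theorem exists_length_two_mdeg_inv {d₁ d₂ : ℕ} (h₁ : 1 < d₁) (h₂ : d₁ < d₂) (hdvd : d₁ ∣ d₂)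
    {L : Aut 2} {a b c : Fin 2 → ℂ} (hL : HasAffineForm L.val a b c) :
    ∃ F : Aut 2, length F = 2 ∧ mdeg F.val = ![d₁, d₂] ∧
      mdeg (F⁻¹).val = fun i => if b i = 0 then d₂ / d₁ else d₂ := by
  obtain ⟨e, rfl⟩ := hdvd
  have he : 1 < e := by nlinarith
  have hdiv : d₁ * e / d₁ = e := Nat.mul_div_cancel_left _ (by omega)
  have hf : 1 < (Polynomial.X ^ d₁ : Polynomial ℂ).natDegree := by simpa
  have hg : 1 < (Polynomial.X ^ e : Polynomial ℂ).natDegree := by simpa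
  have hLi : IsAffine L⁻¹ := hL.isAffine.inv
  have hm : mdeg (swap * (upper (Polynomial.X ^ e) * lower (Polynomial.X ^ d₁)) * L⁻¹).val =
      ![d₁, d₁ * e] := by
    funext i
    rw [mdeg_affine_mul_upper_mul_lower hLi swap_form hf hg i]
    fin_cases i <;> simp [mul_comm]
  refine ⟨_, length_eq_two (hasDecomposition_two_iff.mpr
    ⟨_, _, _, _, hLi, swap_form.isAffine, hf, hg, rfl⟩) ?_ ?_, hm, ?_⟩
  · rw [hm]; exact h₁
  · rw [hm]; exact h₂
  · funext i
    have einv : (swap * (upper (Polynomial.X ^ e) * lower (Polynomial.X ^ d₁)) * L⁻¹)⁻¹ =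
        L * (lower (-Polynomial.X ^ d₁) * upper (-Polynomial.X ^ e)) * swap := by
      simp only [← lower_inv, ← upper_inv, mul_inv_rev, inv_inv, swap_inv, mul_assoc]
    rw [einv, mdeg_affine_mul_lower_mul_upper swap_form.isAffine hL (by simpa) (by simpa), hdiv]
    simp

end PolyAut

theorem mainTheorem11 (d₁ d₂ : ℕ) (h₁ : 1 < d₁) (h₂ : d₁ < d₂) (hdvd : d₁ ∣ d₂) :
    (∀ F : PolyAut.Aut 2, PolyAut.length F = 2 → PolyAut.mdeg F.val = ![d₁, d₂] →
      PolyAut.mdeg (F⁻¹).val ∈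
        ({![d₂, d₂ / d₁], ![d₂ / d₁, d₂], ![d₂, d₂]} : Set (Fin 2 → ℕ))) ∧
    (∃ F : PolyAut.Aut 2, PolyAut.length F = 2 ∧ PolyAut.mdeg F.val = ![d₁, d₂] ∧
      PolyAut.mdeg (F⁻¹).val = ![d₂, d₂ / d₁]) ∧
    (∃ F : PolyAut.Aut 2, PolyAut.length F = 2 ∧ PolyAut.mdeg F.val = ![d₁, d₂] ∧
      PolyAut.mdeg (F⁻¹).val = ![d₂ / d₁, d₂]) ∧
    (∃ F : PolyAut.Aut 2, PolyAut.length F = 2 ∧ PolyAut.mdeg F.val = ![d₁, d₂] ∧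
      PolyAut.mdeg (F⁻¹).val = ![d₂, d₂]) := by
  refine ⟨fun F hF hd => ?_, ?_, ?_, ?_⟩
  -- The infimum of the empty set is 0, so length 2 ensures that a decomposition exists.
  · have hne : {l : ℕ | PolyAut.HasDecomposition F l}.Nonempty :=
      Nat.nonempty_of_pos_sInf (by change 0 < PolyAut.length F; omega)
    have hmem : PolyAut.HasDecomposition F (PolyAut.length F) := Nat.sInf_mem hne
    exact PolyAut.mdeg_inv_mem h₂ (hF ▸ hmem) hd
  · obtain ⟨F, hl, hm, hi⟩ := PolyAut.exists_length_two_mdeg_inv h₁ h₂ hdvd PolyAut.swap_form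
    exact ⟨F, hl, hm, hi.trans (by funext i; fin_cases i <;> simp)⟩
  · obtain ⟨F, hl, hm, hi⟩ := PolyAut.exists_length_two_mdeg_inv h₁ h₂ hdvd PolyAut.one_form
    exact ⟨F, hl, hm, hi.trans (by funext i; fin_cases i <;> simp)⟩
  -- The shear (x + y, y) has both y-coefficients nonzero.
  · obtain ⟨F, hl, hm, hi⟩ := PolyAut.exists_length_two_mdeg_inv h₁ h₂ hdvd PolyAut.upper_X_form
    exact ⟨F, hl, hm, hi.trans (by funext i; fin_cases i <;> simp)⟩
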